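/- For a topological space $Y$ let $\mathcal F(Y)$ be the set of all nonempty closed subsets of $Y$ with the Vietoris topology, i.e. the topology generated by the sets $\{F: F\subseteq V\}$ and $\{F: F\cap V\neq\emptyset\}$, where $V$ runs over the open subsets of $Y$. There exists a mapping $f:\mathbb R\to\mathcal F(\mathbb R)$ with the following properties. (1) $f$ is Baire-one: it is the pointwise limit of a sequence of continuous mappings $\mathbb R\to\mathcal F(\mathbb R)$. (2) $f$ is $F_\sigma$-measurable: $f^{-1}(V)$ is an $F_\sigma$-set in $\mathbb R$ for every open $V\subseteq\mathcal F(\mathbb R)$. (3) $f$ is Darboux: $f(I)$ is connected for every connected $I\subseteq\mathbb R$. (4) The restriction $f|_C$ of $f$ to the (ternary) Cantor set $C\subseteq\mathbb R$ is discontinuous at every point of $C$; hence $f$ is not barely continuous, i.e. it is not true that for every nonempty closed $F\subseteq\mathbb R$ the restriction $f|_F$ has a point of continuity. (5) The subspace $f(\mathbb R)$ of $\mathcal F(\mathbb R)$ is hereditarily Lindelöf; moreover it is perfectly normal (that is, $T_1$, normal, and with every closed set a $G_\delta$-set). -/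

import Mathlib

open Set Filter Topology

/-- The hyperspace `𝓕(Y)` of all nonempty closed subsets of a topological space `Y`. -/
structure NonemptyClosedSubsets (Y : Type*) [TopologicalSpace Y] where
  /-- the underlying set -/
  carrier : Set Y
  isClosed : IsClosed carrier
  nonempty : carrier.Nonempty

/-- The Vietoris topology on `𝓕(Y)`. -/
instance (Y : Type*) [TopologicalSpace Y] : TopologicalSpace (NonemptyClosedSubsets Y) :=
  TopologicalSpace.induced NonemptyClosedSubsets.carrier (TopologicalSpace.vietoris Y)

/-- The topology on `𝓕(Y)` is generated by the sets `{F | F ⊆ V}` and `{F | F ∩ V ≠ ∅}`,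
with `V` open in `Y`. -/
theorem NonemptyClosedSubsets.topology_eq_generateFrom (Y : Type*) [TopologicalSpace Y] :
    (inferInstance : TopologicalSpace (NonemptyClosedSubsets Y)) =
      TopologicalSpace.generateFrom
        ({W | ∃ V : Set Y, IsOpen V ∧ W = {F | F.carrier ⊆ V}} ∪
          {W | ∃ V : Set Y, IsOpen V ∧ W = {F | (F.carrier ∩ V).Nonempty}}) := by
  change TopologicalSpace.induced _ (TopologicalSpace.vietoris Y) = _
  rw [TopologicalSpace.vietoris, induced_generateFrom_eq]
  congr 1
  ext W
  simp only [image_union, mem_union, mem_image, mem_ofPred_eq]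
  constructor
  · rintro (⟨_, ⟨V, hV, rfl⟩, rfl⟩ | ⟨_, ⟨V, hV, rfl⟩, rfl⟩)
    · exact Or.inl ⟨V, hV, rfl⟩
    · exact Or.inr ⟨V, hV, rfl⟩
  · rintro (⟨V, hV, rfl⟩ | ⟨V, hV, rfl⟩)
    · exact Or.inl ⟨_, ⟨V, hV, rfl⟩, rfl⟩
    · exact Or.inr ⟨_, ⟨V, hV, rfl⟩, rfl⟩

/-- An `F_σ`-set: a countable union of closed sets. -/
def IsFSigma {X : Type*} [TopologicalSpace X] (s : Set X) : Prop :=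
  ∃ F : ℕ → Set X, (∀ n, IsClosed (F n)) ∧ s = ⋃ n, F n

/-- `f` is `F_σ`-measurable: preimages of open sets are `F_σ`-sets. -/
def FSigmaMeasurable {X Y : Type*} [TopologicalSpace X] [TopologicalSpace Y] (f : X → Y) : Prop :=
  ∀ V : Set Y, IsOpen V → IsFSigma (f ⁻¹' V)

/-- `f` is Baire-one: a pointwise limit of a sequence of continuous mappings `X → Y`. -/
def IsBaireOne {X Y : Type*} [TopologicalSpace X] [TopologicalSpace Y] (f : X → Y) : Prop :=
  ∃ g : ℕ → X → Y, (∀ n, Continuous (g n)) ∧ ∀ x, Tendsto (fun n => g n x) atTop (𝓝 (f x))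

/-- `f` is Darboux: images of connected sets are connected. -/
def IsDarboux {X Y : Type*} [TopologicalSpace X] [TopologicalSpace Y] (f : X → Y) : Prop :=
  ∀ C : Set X, IsConnected C → IsConnected (f '' C)

/-- `f` is barely continuous: its restriction to every nonempty closed subspace has a
continuity point. -/
def BarelyContinuous {X Y : Type*} [TopologicalSpace X] [TopologicalSpace Y] (f : X → Y) : Prop :=
  ∀ F : Set X, IsClosed F → F.Nonempty → ∃ x : F, ContinuousAt (F.domRestrict f) x

/-! Let `A = range a` be the set of points of the Cantor set `C` isolated in `C` from the right; it
is countable. A lower semicontinuous potential `S` (`gapPotential`) satisfies `S (a k) ≤ k`, is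
infinite on `C \ A`, and is finite and continuous off `C`. Put `c i x = S x - i` if `a i < x` and
`0` otherwise, and let `f x` be the union of the intervals `[2i, 2i + min 1 (c i x)]`.

Each `c i` is lower semicontinuous, hence a limit of continuous functions from below, which makes
`f` Baire-one. Off `A` the map `f` is left continuous (`tendsto_gapMap_nhdsLT`). As for the
Sorgenfrey line, this gives `F_σ`-measurability and a hereditarily Lindelöf range; the range is also
regular, hence perfectly normal.

Every value of `f` is a cluster value from both sides, which together with `F_σ`-measurability
yields Darboux by a Baire category argument (`FSigmaMeasurable.isDarboux`). Finally, arbitrarily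
close to each point of `C` there is a point of `C \ A` at which some `c i` has jumped from `0` to
`∞`, so `f` restricted to `C` is nowhere continuous. -/

open scoped ENNReal
open Metric

/-! ### Convergence and separation in the Vietoris topology. -/

namespace NonemptyClosedSubsets

variable {Y : Type*} [TopologicalSpace Y]

theorem isOpen_setOf_subset {V : Set Y} (hV : IsOpen V) :
    IsOpen {F : NonemptyClosedSubsets Y | F.carrier ⊆ V} :=
  isOpen_induced (t := TopologicalSpace.vietoris Y) hV.powerset_vietoris

theorem isOpen_setOf_inter_nonempty {V : Set Y} (hV : IsOpen V) :
    IsOpen {F : NonemptyClosedSubsets Y | (F.carrier ∩ V).Nonempty} :=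
  isOpen_induced (t := TopologicalSpace.vietoris Y)
    (TopologicalSpace.vietoris.isOpen_inter_nonempty_of_isOpen hV)

theorem isClosed_setOf_subset {K : Set Y} (hK : IsClosed K) :
    IsClosed {F : NonemptyClosedSubsets Y | F.carrier ⊆ K} := by
  rw [← isOpen_compl_iff]
  convert isOpen_setOf_inter_nonempty hK.isOpen_compl using 1
  ext F
  simp [Set.inter_compl_nonempty_iff]

theorem isClosed_setOf_inter_nonempty {K : Set Y} (hK : IsClosed K) :
    IsClosed {F : NonemptyClosedSubsets Y | (F.carrier ∩ K).Nonempty} := by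
  rw [← isOpen_compl_iff]
  convert isOpen_setOf_subset hK.isOpen_compl using 1
  ext F
  simp [Set.not_nonempty_iff_eq_empty, Set.subset_compl_iff_disjoint_right,
    Set.disjoint_iff_inter_eq_empty]

theorem tendsto_nhds_iff {ι : Type*} {l : Filter ι} {u : ι → NonemptyClosedSubsets Y}
    {F : NonemptyClosedSubsets Y} :
    Tendsto u l (𝓝 F) ↔
      (∀ V, IsOpen V → F.carrier ⊆ V → ∀ᶠ i in l, (u i).carrier ⊆ V) ∧
      (∀ V, IsOpen V → (F.carrier ∩ V).Nonempty → ∀ᶠ i in l, ((u i).carrier ∩ V).Nonempty) := by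
  constructor
  · exact fun h => ⟨fun V hV hF => h ((isOpen_setOf_subset hV).mem_nhds hF),
      fun V hV hF => h ((isOpen_setOf_inter_nonempty hV).mem_nhds hF)⟩
  · rintro ⟨h₁, h₂⟩
    have e : (𝓝 F : Filter (NonemptyClosedSubsets Y)) = _ :=
      congrArg (fun t => @nhds _ t F) (topology_eq_generateFrom Y)
    rw [e, TopologicalSpace.tendsto_nhds_generateFrom_iff]
    rintro _ (⟨V, hV, rfl⟩ | ⟨V, hV, rfl⟩) hF
    · exact h₁ V hV hF
    · exact h₂ V hV hF

instance : T0Space (NonemptyClosedSubsets Y) where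
  t0 F G h := by
    have key : ∀ F G : NonemptyClosedSubsets Y, Inseparable F G → F.carrier ⊆ G.carrier := by
      intro F G h r hr
      by_contra hG
      obtain ⟨s, hs, hs'⟩ := (h.mem_open_iff
        (isOpen_setOf_inter_nonempty G.isClosed.isOpen_compl)).1 ⟨r, hr, hG⟩
      exact hs' hs
    have := (key F G h).antisymm (key G F h.symm)
    cases F; cases G; congr

/-- Normality puts a closed set `closure W` between `F` (or the closure of a point of `F`) and `V`,
and the miss and hit sets of `closure W` are closed in the hyperspace. -/
instance [NormalSpace Y] [R0Space Y] : RegularSpace (NonemptyClosedSubsets Y) := by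
  refine RegularSpace.of_lift'_closure_le fun F => ?_
  have : Tendsto (id : NonemptyClosedSubsets Y → _) ((𝓝 F).lift' closure) (𝓝 F) := by
    have closed_mem : ∀ S T : Set (NonemptyClosedSubsets Y), S ∈ 𝓝 F → IsClosed T → S ⊆ T →
        T ∈ (𝓝 F).lift' closure := fun S T hS hT hST =>
      mem_of_superset (mem_lift' hS) (closure_minimal hST hT)
    rw [tendsto_nhds_iff]
    constructor
    · intro V hV hF
      obtain ⟨W, hW, hFW, hWV⟩ := normal_exists_closure_subset F.isClosed hV hF
      refine mem_of_superset (closed_mem _ _ ((isOpen_setOf_subset hW).mem_nhds hFW)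
        (isClosed_setOf_subset isClosed_closure) fun G hG => ?_) fun G hG => hG.trans hWV
      exact Subset.trans hG subset_closure
    · rintro V hV ⟨r, hr, hrV⟩
      have hcl : closure {r} ⊆ V := by
        intro s hs
        have := (specializes_iff_mem_closure.2 hs).symm
        exact this.mem_open hV hrV
      obtain ⟨W, hW, hrW, hWV⟩ := normal_exists_closure_subset isClosed_closure hV hcl
      refine mem_of_superset (closed_mem _ _ ((isOpen_setOf_inter_nonempty hW).mem_nhds
        ⟨r, hr, hrW (subset_closure rfl)⟩)
        (isClosed_setOf_inter_nonempty (isClosed_closure (s := W))) fun G hG => ?_) fun G hG => ?_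
      · exact Nonempty.mono (inter_subset_inter_right _ subset_closure) hG
      · exact Nonempty.mono (inter_subset_inter_right _ hWV) hG
  exact this

end NonemptyClosedSubsets

/-- Regular Lindelöf spaces are normal. For the `G_δ` property, cover `Kᶜ` by countably many open
sets whose closures miss `K`. -/
theorem T6Space.of_regularSpace_hereditarilyLindelofSpace (X : Type*) [TopologicalSpace X]
    [T0Space X] [RegularSpace X] [HereditarilyLindelofSpace X] : T6Space X where
  closed_gdelta K hK := by
    have h : ∀ x : ↥Kᶜ, ∃ t, IsOpen t ∧ (x : X) ∈ t ∧ closure t ⊆ Kᶜ := fun x => by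
      obtain ⟨t, ht, htc, htK⟩ := exists_mem_nhds_isClosed_subset (hK.isOpen_compl.mem_nhds x.2)
      exact ⟨interior t, isOpen_interior, mem_interior_iff_mem_nhds.2 ht,
        (closure_minimal interior_subset htc).trans htK⟩
    choose t ht hxt htK using h
    obtain ⟨T, hT, hTU⟩ := eq_open_union_countable t ht
    have : K = ⋂ i ∈ T, (closure (t i))ᶜ := by
      apply Subset.antisymm
      · exact subset_iInter₂ fun i _ x hx hxi => htK i hxi hx
      · intro x hx
        by_contra hxK
        have : x ∈ ⋃ i ∈ T, t i := hTU ▸ mem_iUnion.2 ⟨⟨x, hxK⟩, hxt _⟩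
        simp only [mem_iUnion, exists_prop] at this
        obtain ⟨i, hi, hxi⟩ := this
        exact mem_iInter₂.1 hx i hi (subset_closure hxi)
    rw [this]
    exact .biInter hT fun i _ => isClosed_closure.isOpen_compl.isGδ

/-! ### Maps on the line that are left continuous off a countable set. -/

/-- A union of sets that are left neighbourhoods of all but countably many of their points differs
from the union of the interiors by a countable set. -/
theorem countable_iUnion_diff_iUnion_interior {ι : Type*} {W : ι → Set ℝ} {A : Set ℝ}
    (hA : A.Countable) (hW : ∀ i, ∀ x ∈ W i, x ∉ A → W i ∈ 𝓝[<] x) :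
    ((⋃ i, W i) \ ⋃ i, interior (W i)).Countable := by
  set N := (⋃ i, W i) \ ⋃ i, interior (W i) with hN
  -- A point of `N` outside `A` ends an interval `(y, x)` inside the interior of some `W i`, so it
  -- is isolated from the left in `N`; a subset of `ℝ` has only countably many such points.
  refine (hA.union (countable_setOfPred_isolated_left_within (s := N))).mono fun x hx => ?_
  by_cases hxA : x ∈ A
  · exact Or.inl hxA
  refine Or.inr ⟨hx, ?_⟩
  obtain ⟨i, hi⟩ := mem_iUnion.1 hx.1
  obtain ⟨y, hy, hyW⟩ := mem_nhdsLT_iff_exists_Ioo_subset.1 (hW i x hi hxA)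
  rw [← empty_mem_iff_bot, mem_nhdsWithin]
  refine ⟨Ioi y, isOpen_Ioi, hy, ?_⟩
  rintro z ⟨hyz, hzN, hzx⟩
  exact (hzN.2 (mem_iUnion.2 ⟨i, mem_interior.2 ⟨_, hyW, isOpen_Ioo, hyz, hzx⟩⟩)).elim

section LeftContinuous

variable {Y : Type*} [TopologicalSpace Y] {f : ℝ → Y} {A : Set ℝ}

/-- The preimage of an open set is its interior, an `F_σ`-set, plus countably many points. -/
theorem FSigmaMeasurable.of_tendsto_nhdsLT (hA : A.Countable)
    (hf : ∀ x ∉ A, Tendsto f (𝓝[<] x) (𝓝 (f x))) : FSigmaMeasurable f := by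
  intro V hV
  have hc := countable_iUnion_diff_iUnion_interior (W := fun _ : Unit => f ⁻¹' V) hA
    fun _ x hx hxA => hf x hxA (hV.mem_nhds hx)
  simp only [iUnion_const] at hc
  obtain ⟨F, hF, -, hFU, -⟩ := (isOpen_interior (s := f ⁻¹' V)).exists_iUnion_isClosed
  have : Countable ↥(f ⁻¹' V \ interior (f ⁻¹' V)) := hc.to_subtype
  obtain ⟨e, he⟩ := exists_surjective_nat (ℕ ⊕ Option ↥(f ⁻¹' V \ interior (f ⁻¹' V)))
  let G : ℕ ⊕ Option ↥(f ⁻¹' V \ interior (f ⁻¹' V)) → Set ℝ :=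
    Sum.elim F (fun o => o.elim ∅ fun x => {(x : ℝ)})
  refine ⟨fun n => G (e n), fun n => ?_, ?_⟩
  · change IsClosed (G (e n))
    rcases e n with k | _ | x
    exacts [hF k, isClosed_empty, isClosed_singleton]
  · rw [he.iUnion_comp G]
    apply Subset.antisymm
    · intro x hx
      by_cases h : x ∈ interior (f ⁻¹' V)
      · rw [← hFU] at h
        obtain ⟨n, hn⟩ := mem_iUnion.1 h
        exact mem_iUnion.2 ⟨Sum.inl n, hn⟩
      · exact mem_iUnion.2 ⟨Sum.inr (some ⟨x, hx, h⟩), rfl⟩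
    · refine iUnion_subset ?_
      rintro (n | _ | x)
      · exact ((subset_iUnion F n).trans hFU.subset).trans interior_subset
      · exact empty_subset _
      · exact singleton_subset_iff.2 x.2.1

/-- Pull a cover back to `ℝ`: the interiors have a countable subcover by second countability, and
only countably many points are left over. -/
theorem hereditarilyLindelofSpace_range_of_tendsto_nhdsLT (hA : A.Countable)
    (hf : ∀ x ∉ A, Tendsto f (𝓝[<] x) (𝓝 (f x))) : HereditarilyLindelofSpace (range f) := by
  refine HereditarilyLindelofSpace.of_forall_isOpen fun s _ => ?_
  refine isLindelof_of_countable_subcover fun {ι} U hU hsU => ?_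
  choose O hO hOU using fun i => isOpen_induced_iff.1 (hU i)
  have hc := countable_iUnion_diff_iUnion_interior (W := fun i => f ⁻¹' O i) hA
    fun i x hx hxA => hf x hxA ((hO i).mem_nhds hx)
  obtain ⟨T, hT, hTU⟩ := TopologicalSpace.isOpen_iUnion_countable
    (fun i => interior (f ⁻¹' O i)) fun i => isOpen_interior
  choose j hj using fun x : ↥((⋃ i, f ⁻¹' O i) \ ⋃ i, interior (f ⁻¹' O i)) =>
    mem_iUnion.1 x.2.1
  have := hc.to_subtype
  refine ⟨T ∪ range j, hT.union (countable_range j), ?_⟩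
  rintro ⟨_, x, rfl⟩ hx
  have mem : ∀ i, f x ∈ O i → (⟨f x, x, rfl⟩ : range f) ∈ U i := fun i hi => hOU i ▸ hi
  have hxU : x ∈ ⋃ i, f ⁻¹' O i := by
    obtain ⟨i, hi⟩ := mem_iUnion.1 (hsU hx)
    rw [← hOU i] at hi
    exact mem_iUnion.2 ⟨i, hi⟩
  by_cases h : x ∈ ⋃ i, interior (f ⁻¹' O i)
  · rw [← hTU] at h
    obtain ⟨i, hi, hxi⟩ := mem_iUnion₂.1 h
    exact mem_iUnion₂.2 ⟨i, Or.inl hi, mem i (interior_subset hxi : x ∈ f ⁻¹' O i)⟩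
  · exact mem_iUnion₂.2 ⟨j ⟨x, hxU, h⟩, Or.inr ⟨_, rfl⟩, mem _ (hj ⟨x, hxU, h⟩)⟩

end LeftContinuous

/-! ### A Baire category criterion for the Darboux property. -/

section Darboux

variable {Y : Type*} [TopologicalSpace Y] {f : ℝ → Y}

/-- Given a splitting of an interval by two open sets, no portion of the common boundary lies on
one side of the splitting, if `f` has bilateral cluster points. -/
theorem not_boundary_subset_of_mapClusterPt
    (hl : ∀ x, MapClusterPt (f x) (𝓝[<] x) f) (hr : ∀ x, MapClusterPt (f x) (𝓝[>] x) f)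
    {I : Set ℝ} (hI : I.OrdConnected) {U V : Set Y} (hU : IsOpen U)
    (hcov : ∀ x ∈ I, f x ∈ U ∨ f x ∈ V) (hdis : ∀ x ∈ I, f x ∈ U → f x ∉ V)
    {O : Set ℝ} (hO : IsOpen O) {z : ℝ} (hzO : z ∈ O) (hzI : z ∈ I)
    (hzP : z ∈ closure (I ∩ f ⁻¹' U)) (hzQ : z ∈ closure (I ∩ f ⁻¹' V))
    (hOU : ∀ x ∈ O, x ∈ I → x ∈ closure (I ∩ f ⁻¹' U) → x ∈ closure (I ∩ f ⁻¹' V) → f x ∈ U) :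
    False := by
  obtain ⟨u, v, hzuv, huv⟩ := mem_nhds_iff_exists_Ioo_subset.1 (hO.mem_nhds hzO)
  obtain ⟨q, hq, hqI, hqV⟩ := mem_closure_iff.1 hzQ _ isOpen_Ioo hzuv
  set P := I ∩ f ⁻¹' U with hP
  set Q := I ∩ f ⁻¹' V with hQ
  have hqP : q ∉ closure P := fun h =>
    hdis q hqI (hOU q (huv hq) hqI h (subset_closure ⟨hqI, hqV⟩)) hqV
  have side : ∀ x ∈ I, x ∉ closure P → x ∈ Q := fun x hx hxP =>
    ⟨hx, (hcov x hx).resolve_left fun h => hxP (subset_closure ⟨hx, h⟩)⟩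
  rcases lt_trichotomy z q with h | h | h
  -- Let `s` be the last point of `closure P` before `q`. Then `(s, q) ⊆ Q`, so `s` is a common
  -- boundary point and `f s ∈ U`, although `f` avoids `U` just to the right of `s`.
  · have hK : IsCompact (Icc z q ∩ closure P) := isCompact_Icc.inter_right isClosed_closure
    have hKne : (Icc z q ∩ closure P).Nonempty := ⟨z, ⟨le_rfl, h.le⟩, hzP⟩
    obtain ⟨⟨hzs, hsq⟩, hsP⟩ := hK.sSup_mem hKne
    have hmax : ∀ x ∈ Icc z q ∩ closure P, x ≤ sSup (Icc z q ∩ closure P) :=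
      fun x hx => le_csSup hK.bddAbove hx
    generalize sSup (Icc z q ∩ closure P) = s at *
    have hsq' : s < q := lt_of_le_of_ne hsq fun e => hqP (e ▸ hsP)
    have hsI : s ∈ I := hI.out hzI hqI ⟨hzs, hsq⟩
    have hright : Ioo s q ⊆ Q := fun x hx => side x (hI.out hsI hqI (Ioo_subset_Icc_self hx))
      fun hxP => (hmax x ⟨⟨hzs.trans hx.1.le, hx.2.le⟩, hxP⟩).not_gt hx.1
    have hsQ : s ∈ closure Q := closure_mono hright (by
      rw [closure_Ioo hsq'.ne]; exact ⟨le_rfl, hsq⟩)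
    have hsU : f s ∈ U := hOU s (huv ⟨hzuv.1.trans_le hzs, hsq.trans_lt hq.2⟩) hsI hsP hsQ
    obtain ⟨y, hyU, hy⟩ := (((mapClusterPt_iff_frequently.1 (hr s)) U
      (hU.mem_nhds hsU)).and_eventually (Ioo_mem_nhdsGT hsq')).exists
    exact hdis y (hright hy).1 hyU (hright hy).2
  · exact hqP (h ▸ hzP)
  · have hK : IsCompact (Icc q z ∩ closure P) := isCompact_Icc.inter_right isClosed_closure
    have hKne : (Icc q z ∩ closure P).Nonempty := ⟨z, ⟨h.le, le_rfl⟩, hzP⟩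
    obtain ⟨⟨hqs, hsz⟩, hsP⟩ := hK.sInf_mem hKne
    have hmin : ∀ x ∈ Icc q z ∩ closure P, sInf (Icc q z ∩ closure P) ≤ x :=
      fun x hx => csInf_le hK.bddBelow hx
    generalize sInf (Icc q z ∩ closure P) = s at *
    have hqs' : q < s := lt_of_le_of_ne hqs fun e => hqP (e ▸ hsP)
    have hsI : s ∈ I := hI.out hqI hzI ⟨hqs, hsz⟩
    have hleft : Ioo q s ⊆ Q := fun x hx => side x (hI.out hqI hsI (Ioo_subset_Icc_self hx))
      fun hxP => (hmin x ⟨⟨hx.1.le, hx.2.le.trans hsz⟩, hxP⟩).not_gt hx.2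
    have hsQ : s ∈ closure Q := closure_mono hleft (by
      rw [closure_Ioo hqs'.ne]; exact ⟨hqs, le_rfl⟩)
    have hsU : f s ∈ U := hOU s (huv ⟨hq.1.trans_le hqs, hsz.trans_lt hzuv.2⟩) hsI hsP hsQ
    obtain ⟨y, hyU, hy⟩ := (((mapClusterPt_iff_frequently.1 (hl s)) U
      (hU.mem_nhds hsU)).and_eventually (Ioo_mem_nhdsLT hqs')).exists
    exact hdis y (hleft hy).1 hyU (hleft hy).2

/-- An `F_σ`-measurable map on `ℝ` is Darboux if each of its values is a cluster value from both
sides. -/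
theorem FSigmaMeasurable.isDarboux (hf : FSigmaMeasurable f)
    (hl : ∀ x, MapClusterPt (f x) (𝓝[<] x) f) (hr : ∀ x, MapClusterPt (f x) (𝓝[>] x) f) :
    IsDarboux f := by
  have main : ∀ a b : ℝ, IsPreconnected (f '' Icc a b) := by
    rintro a b U V hU hV hUV ⟨_, ⟨p, hp, rfl⟩, hpU⟩ ⟨_, ⟨q, hq, rfl⟩, hqV⟩
    by_contra hne
    have hcov : ∀ x ∈ Icc a b, f x ∈ U ∨ f x ∈ V := fun x hx => hUV ⟨x, hx, rfl⟩
    have hdis : ∀ x ∈ Icc a b, f x ∈ U → f x ∉ V := fun x hx h h' =>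
      hne ⟨f x, ⟨x, hx, rfl⟩, h, h'⟩
    set P := Icc a b ∩ f ⁻¹' U with hP
    set Q := Icc a b ∩ f ⁻¹' V with hQ
    obtain ⟨x, hxI, hxP, hxQ⟩ : (Icc a b ∩ (closure P ∩ closure Q)).Nonempty := by
      refine isPreconnected_closed_iff.1 isPreconnected_Icc _ _ isClosed_closure isClosed_closure
        (fun x hx => ?_) ⟨p, hp, subset_closure ⟨hp, hpU⟩⟩ ⟨q, hq, subset_closure ⟨hq, hqV⟩⟩
      exact (hcov x hx).imp (fun h => subset_closure ⟨hx, h⟩) fun h => subset_closure ⟨hx, h⟩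
    -- The common boundary `B` is covered by the closed pieces of the two preimages; by Baire one
    -- piece contains a portion of `B`, where `f` stays on one side.
    set B := Icc a b ∩ (closure P ∩ closure Q) with hB
    have hBc : IsClosed B := isClosed_Icc.inter (isClosed_closure.inter isClosed_closure)
    have : CompleteSpace B := hBc.completeSpace_coe
    have : Nonempty B := ⟨⟨x, hxI, hxP, hxQ⟩⟩
    obtain ⟨F, hF, hFU⟩ := hf U hU
    obtain ⟨G, hG, hGV⟩ := hf V hV
    let H : ℕ ⊕ ℕ → Set B := Sum.elim (fun n => (↑) ⁻¹' F n) fun n => (↑) ⁻¹' G n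
    have hH : ∀ i, IsClosed (H i) := by
      rintro (n | n)
      exacts [(hF n).preimage continuous_subtype_val, (hG n).preimage continuous_subtype_val]
    have hHU : ⋃ i, H i = univ := by
      refine eq_univ_of_forall fun y => ?_
      rcases hcov y y.2.1 with h | h
      · obtain ⟨n, hn⟩ := mem_iUnion.1 (hFU.subset h)
        exact mem_iUnion.2 ⟨Sum.inl n, hn⟩
      · obtain ⟨n, hn⟩ := mem_iUnion.1 (hGV.subset h)
        exact mem_iUnion.2 ⟨Sum.inr n, hn⟩
    obtain ⟨i, y, hy⟩ := nonempty_interior_of_iUnion_of_closed hH hHU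
    obtain ⟨T, hTH, hT, hyT⟩ := mem_interior.1 hy
    obtain ⟨O, hO, rfl⟩ := isOpen_induced_iff.1 hT
    rcases i with n | n
    · refine not_boundary_subset_of_mapClusterPt hl hr ordConnected_Icc hU hcov hdis hO hyT y.2.1
        y.2.2.1 y.2.2.2 fun z hzO hzI hzP hzQ => ?_
      exact hFU.superset (mem_iUnion.2 ⟨n, hTH (show (⟨z, hzI, hzP, hzQ⟩ : B) ∈ _ from hzO)⟩)
    · refine not_boundary_subset_of_mapClusterPt hl hr ordConnected_Icc hV
        (fun x hx => (hcov x hx).symm) (fun x hx h h' => hdis x hx h' h) hO hyT y.2.1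
        y.2.2.2 y.2.2.1 fun z hzO hzI hzQ hzP => ?_
      exact hGV.superset (mem_iUnion.2 ⟨n, hTH (show (⟨z, hzI, hzP, hzQ⟩ : B) ∈ _ from hzO)⟩)
  intro C hC
  refine ⟨hC.nonempty.image f, isPreconnected_of_forall_pair ?_⟩
  rintro _ ⟨x, hx, rfl⟩ _ ⟨y, hy, rfl⟩
  exact ⟨f '' uIcc x y, image_mono (hC.isPreconnected.ordConnected.uIcc_subset hx hy),
    ⟨x, left_mem_uIcc, rfl⟩, ⟨y, right_mem_uIcc, rfl⟩, main _ _⟩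

end Darboux

/-! ### Lower semicontinuous functions as limits of Lipschitz functions from below. -/

section LipschitzRegularization

variable {X : Type*} [PseudoEMetricSpace X]

/-- The `n`-Lipschitz regularization of an extended nonnegative function (its inf-convolution with
`n * edist`). -/
noncomputable def lipschitzRegularization (h : X → ℝ≥0∞) (n : ℕ) (x : X) : ℝ≥0∞ :=
  ⨅ y, h y + n * edist x y

theorem continuous_lipschitzRegularization (h : X → ℝ≥0∞) (n : ℕ) :
    Continuous (lipschitzRegularization h n) := by
  refine continuous_of_le_add_edist n (ENNReal.natCast_ne_top n) fun x y => ?_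
  rw [lipschitzRegularization, lipschitzRegularization, ENNReal.iInf_add]
  refine le_iInf fun z => (iInf_le _ z).trans ?_
  rw [add_assoc, ← mul_add, add_comm (edist y z)]
  gcongr
  exact edist_triangle x y z

theorem lipschitzRegularization_le (h : X → ℝ≥0∞) (n : ℕ) (x : X) :
    lipschitzRegularization h n x ≤ h x :=
  (iInf_le _ x).trans (by simp)

/-- Points `y` near `x` have `h y` large by semicontinuity; for those at distance at least `ε` the
term `n * edist x y` is large. -/
theorem LowerSemicontinuous.tendsto_lipschitzRegularization {h : X → ℝ≥0∞}
    (hh : LowerSemicontinuous h) (x : X) :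
    Tendsto (fun n => lipschitzRegularization h n x) atTop (𝓝 (h x)) := by
  refine tendsto_order.2 ⟨fun c hc => ?_, fun c hc =>
    Eventually.of_forall fun n => (lipschitzRegularization_le h n x).trans_lt hc⟩
  obtain ⟨c', hcc', hc'⟩ := exists_between hc
  obtain ⟨ε, hε, hball⟩ := EMetric.mem_nhds_iff.1 (hh x c' hc')
  obtain ⟨n, hn⟩ := ENNReal.exists_nat_mul_gt hε.ne' hc'.ne_top
  filter_upwards [eventually_ge_atTop n] with m hm
  refine hcc'.trans_le (le_iInf fun y => ?_)
  by_cases hy : edist y x < ε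
  · exact (hball hy).le.trans le_self_add
  · calc c' ≤ n * ε := hn.le
      _ ≤ m * edist x y := by
        rw [edist_comm]
        gcongr
        exact not_lt.1 hy
      _ ≤ _ := le_add_self

end LipschitzRegularization

/-! ### Coding sequences by closed subsets of the line. -/

/-- The closed set `⋃ i, [2 i, 2 i + min 1 (c i)]`. -/
noncomputable def intervalUnion (c : ℕ → ℝ≥0∞) : NonemptyClosedSubsets ℝ where
  carrier := ⋃ i : ℕ, Icc (2 * i : ℝ) (2 * i + (min 1 (c i)).toReal)
  isClosed := by
    refine LocallyFinite.isClosed_iUnion (fun x => ⟨Iio (x + 1), Iio_mem_nhds (lt_add_one x), ?_⟩)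
      fun i => isClosed_Icc
    refine (finite_Iio ⌈x + 1⌉₊).subset ?_
    rintro i ⟨y, ⟨hy, -⟩, hyx⟩
    have : (i : ℝ) < x + 1 := by
      have : (0 : ℝ) ≤ i := i.cast_nonneg
      linarith [mem_Iio.1 hyx]
    exact Nat.lt_ceil.2 this
  nonempty := ⟨0, mem_iUnion.2 ⟨0, by simp⟩⟩

theorem mem_intervalUnion {c : ℕ → ℝ≥0∞} {y : ℝ} :
    y ∈ (intervalUnion c).carrier ↔
      ∃ i : ℕ, (2 * i : ℝ) ≤ y ∧ y ≤ 2 * i + (min 1 (c i)).toReal := by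
  simp [intervalUnion]

theorem toReal_min_one_mono {a b : ℝ≥0∞} (h : a ≤ b) : (min 1 a).toReal ≤ (min 1 b).toReal :=
  ENNReal.toReal_mono (min_lt_of_left_lt ENNReal.one_lt_top).ne (min_le_min_left _ h)

/-- An open `V` around the limit may get arbitrarily thin at infinity, so coordinatewise convergence
controls only finitely many intervals; the tail must lie inside the limit. Hitting an open set
involves a single interval. -/
theorem tendsto_intervalUnion {ι : Type*} {l : Filter ι} {c : ι → ℕ → ℝ≥0∞} {d : ℕ → ℝ≥0∞}
    (h : ∀ i, Tendsto (fun k => c k i) l (𝓝 (d i))) {N : ℕ}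
    (hN : ∀ᶠ k in l, ∀ i ≥ N, c k i ≤ d i) :
    Tendsto (fun k => intervalUnion (c k)) l (𝓝 (intervalUnion d)) := by
  have hr : ∀ i : ℕ, Tendsto (fun k => (2 * i : ℝ) + (min 1 (c k i)).toReal) l
      (𝓝 (2 * i + (min 1 (d i)).toReal)) := fun i =>
    tendsto_const_nhds.add ((ENNReal.tendsto_toReal
      (min_lt_of_left_lt ENNReal.one_lt_top).ne).comp (tendsto_const_nhds.min (h i)))
  rw [NonemptyClosedSubsets.tendsto_nhds_iff]
  constructor
  · intro V hV hdV
    have key : ∀ i ∈ Finset.range N, ∀ᶠ k in l,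
        Icc (2 * i : ℝ) (2 * i + (min 1 (c k i)).toReal) ⊆ V := fun i _ => by
      have hi : (2 * i : ℝ) + (min 1 (d i)).toReal ∈ V :=
        hdV (mem_intervalUnion.2 ⟨i, by simp, le_rfl⟩)
      obtain ⟨u, v, huv, hsub⟩ := mem_nhds_iff_exists_Ioo_subset.1 (hV.mem_nhds hi)
      filter_upwards [(hr i).eventually_lt_const huv.2] with k hk y hy
      rcases le_or_gt y (2 * i + (min 1 (d i)).toReal) with hyd | hyd
      · exact hdV (mem_intervalUnion.2 ⟨i, hy.1, hyd⟩)
      · exact hsub ⟨huv.1.trans hyd, hy.2.trans_lt hk⟩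
    filter_upwards [(Finset.eventually_all _).2 key, hN] with k hk hkN y hy
    obtain ⟨i, hi, hi'⟩ := mem_intervalUnion.1 hy
    rcases lt_or_ge i N with hiN | hiN
    · exact hk i (Finset.mem_range.2 hiN) ⟨hi, hi'⟩
    · exact hdV (mem_intervalUnion.2 ⟨i, hi, hi'.trans
        (add_le_add_right (toReal_min_one_mono (hkN i hiN)) _)⟩)
  · rintro V hV ⟨y, hy, hyV⟩
    obtain ⟨i, hi, hi'⟩ := mem_intervalUnion.1 hy
    have hlim : Tendsto (fun k => min y (2 * i + (min 1 (c k i)).toReal)) l (𝓝 y) := by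
      have := (tendsto_const_nhds (x := y)).min (hr i)
      rwa [min_eq_left hi'] at this
    filter_upwards [hlim (hV.mem_nhds hyV)] with k hk
    exact ⟨_, mem_intervalUnion.2 ⟨i, le_min hi (by simp), min_le_right _ _⟩, hk⟩

/-- Truncating to the first `n` coordinates makes the approximants continuous; as they approach from
below, the tail condition in the limit holds with `N = 0`. -/
theorem isBaireOne_intervalUnion {X : Type*} [PseudoEMetricSpace X] {g : ℕ → X → ℝ≥0∞}
    (hg : ∀ i, LowerSemicontinuous (g i)) :
    IsBaireOne fun x => intervalUnion fun i => g i x := by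
  refine ⟨fun n x => intervalUnion fun i =>
    if i < n then lipschitzRegularization (g i) n x else 0, fun n => ?_, fun x => ?_⟩
  · refine continuous_iff_continuousAt.2 fun x =>
      tendsto_intervalUnion (N := n) (fun i => ?_) (Eventually.of_forall fun y i hi => ?_)
    · split_ifs
      · exact (continuous_lipschitzRegularization (g i) n).continuousAt
      · exact tendsto_const_nhds
    · simp [not_lt.2 hi]
  · refine tendsto_intervalUnion (N := 0) (fun i => ?_) (Eventually.of_forall fun n i _ => ?_)
    · refine ((hg i).tendsto_lipschitzRegularization x).congr' ?_
      filter_upwards [eventually_gt_atTop i] with n hn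
      rw [if_pos hn]
    · split_ifs
      · exact lipschitzRegularization_le _ _ _
      · exact zero_le

/-- If arbitrarily close to `x` some coordinate jumps from `0` to at least `1`, then
`intervalUnion ∘ g` is discontinuous at `x`. -/
theorem not_continuousAt_intervalUnion {X : Type*} [TopologicalSpace X] {g : ℕ → X → ℝ≥0∞} {x : X}
    (h : ∃ᶠ y in 𝓝 x, ∃ i, g i x = 0 ∧ 1 ≤ g i y) :
    ¬ ContinuousAt (fun x => intervalUnion fun i => g i x) x := by
  intro hc
  -- The enlarged intervals remain disjoint, so `2 * i + 1`, which enters the set at `y`, is not in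
  -- this neighbourhood when `g i x = 0`.
  have hV : IsOpen (⋃ i : ℕ, Ioo (2 * i - 1 / 2 : ℝ) (2 * i + (min 1 (g i x)).toReal + 1 / 2)) :=
    isOpen_iUnion fun i => isOpen_Ioo
  have hsub : (intervalUnion fun i => g i x).carrier ⊆
      ⋃ i : ℕ, Ioo (2 * i - 1 / 2 : ℝ) (2 * i + (min 1 (g i x)).toReal + 1 / 2) := fun y hy => by
    obtain ⟨i, hi, hi'⟩ := mem_intervalUnion.1 hy
    exact mem_iUnion.2 ⟨i, by linarith, by linarith⟩
  obtain ⟨y, ⟨i, hix, hiy⟩, hy⟩ :=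
    (h.and_eventually ((NonemptyClosedSubsets.tendsto_nhds_iff.1 hc).1 _ hV hsub)).exists
  have hmem : (2 * i + 1 : ℝ) ∈ (intervalUnion fun i => g i y).carrier :=
    mem_intervalUnion.2 ⟨i, by linarith, by simp [min_eq_left hiy]⟩
  obtain ⟨j, hj, hj'⟩ := mem_iUnion.1 (hy hmem)
  have hle : (min 1 (g j x)).toReal ≤ 1 :=
    ENNReal.toReal_mono ENNReal.one_ne_top (min_le_left _ _)
  have h1 : j < i + 1 := by
    have : (j : ℝ) < i + 1 := by linarith
    exact_mod_cast this
  have h2 : i < j + 1 := by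
    have : (i : ℝ) < j + 1 := by linarith
    exact_mod_cast this
  obtain rfl : i = j := by omega
  simp [hix] at hj'
  linarith

/-! ### The potential, the coordinates and the map attached to a closed set. -/

/-- The points of `C` that are isolated from the right in `C`. -/
def rightIsolated (C : Set ℝ) : Set ℝ := {x ∈ C | 𝓝[C ∩ Ioi x] x = ⊥}

theorem mem_rightIsolated_iff {C : Set ℝ} {x : ℝ} :
    x ∈ rightIsolated C ↔ x ∈ C ∧ ∀ᶠ y in 𝓝[>] x, y ∉ C := by
  rw [rightIsolated, mem_ofPred_eq, inter_comm, nhdsWithin_inter', inf_principal_eq_bot]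
  rfl

theorem countable_rightIsolated (C : Set ℝ) : (rightIsolated C).Countable :=
  countable_setOfPred_isolated_right_within

/-- The distance to `b`, penalized near `C`: it is infinite on `C \ {b}` and vanishes at `b`. -/
noncomputable def gapPenalty (C : Set ℝ) (b x : ℝ) : ℝ≥0∞ :=
  edist x b / infEDist x C ^ (1 / 2 : ℝ)

/-- A lower semicontinuous function, equal to the least index of `x` in the enumeration `a` of a
subset of `C` and infinite on the rest of `C`. -/
noncomputable def gapPotential (C : Set ℝ) (a : ℕ → ℝ) (x : ℝ) : ℝ≥0∞ :=
  ⨅ k : ℕ, k + gapPenalty C (a k) x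

/-- The coordinates of the map into the hyperspace. -/
noncomputable def gapCoord (C : Set ℝ) (a : ℕ → ℝ) (i : ℕ) (x : ℝ) : ℝ≥0∞ :=
  if a i < x then gapPotential C a x - i else 0

section

variable {C : Set ℝ} {a : ℕ → ℝ} {b x : ℝ}

/-- For `b ∈ C` this is the convention `0 / 0 = 0` in `ℝ≥0∞`. -/
theorem gapPenalty_self : gapPenalty C b b = 0 := by simp [gapPenalty]

theorem gapPenalty_eq_top (hx : x ∈ C) (h : x ≠ b) : gapPenalty C b x = ⊤ := by
  rw [gapPenalty, infEDist_zero_of_mem hx, ENNReal.zero_rpow_of_pos (by norm_num)]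
  exact ENNReal.div_zero (edist_pos.2 h).ne'

theorem continuousAt_gapPenalty (h : x ≠ b) :
    ContinuousAt (gapPenalty C b) x :=
  ENNReal.Tendsto.div (continuous_id.edist continuous_const).continuousAt
    (Or.inl (edist_pos.2 h).ne')
    ((ENNReal.continuous_rpow_const.comp continuous_infEDist).continuousAt)
    (Or.inr (edist_ne_top _ _))

/-- Along such an approach the quotient is at most `K * edist y x ^ (1 / 2)`. This is the purpose of
the square root: the exponent `1` would only bound the penalty by `K`. -/
theorem tendsto_gapPenalty {l : Filter ℝ} {K : ℝ≥0∞} (hK : K ≠ ⊤) (hx : x ∈ C) (hl : l ≤ 𝓝 x)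
    (h : ∀ᶠ y in l, edist y x ≤ K * infEDist y C) : Tendsto (gapPenalty C x) l (𝓝 0) := by
  have hlim : Tendsto (fun y => K * edist y x ^ (1 / 2 : ℝ)) l (𝓝 0) := by
    have h1 : Tendsto (fun y : ℝ => edist y x ^ (1 / 2 : ℝ)) (𝓝 x) (𝓝 (edist x x ^ (1 / 2 : ℝ))) :=
      (ENNReal.continuous_rpow_const.comp (continuous_id.edist continuous_const)).tendsto x
    rw [edist_self, ENNReal.zero_rpow_of_pos (by norm_num)] at h1
    simpa using ENNReal.Tendsto.const_mul (h1.mono_left hl) (Or.inr hK)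
  refine tendsto_of_tendsto_of_tendsto_of_le_of_le' tendsto_const_nhds hlim
    (Eventually.of_forall fun _ => zero_le) (h.mono fun y hy => ?_)
  refine ENNReal.div_le_of_le_mul (hy.trans ?_)
  calc K * infEDist y C = K * infEDist y C ^ (1 / 2 : ℝ) * infEDist y C ^ (1 / 2 : ℝ) := by
        rw [mul_assoc, ← ENNReal.rpow_add_of_nonneg _ _ (by norm_num) (by norm_num)]
        norm_num
    _ ≤ _ := by
        gcongr
        exact infEDist_le_edist_of_mem hx

/-- The summand `k` leaves only finitely many terms relevant below a given level. Each is continuous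
except possibly at `a k`, where it attains its minimum. -/
theorem lowerSemicontinuous_gapPotential :
    LowerSemicontinuous (gapPotential C a) := by
  intro x c hc
  obtain ⟨c', hcc', hc'⟩ := exists_between hc
  obtain ⟨M, hM⟩ := ENNReal.exists_nat_gt hc'.ne_top
  have key : ∀ k ∈ Finset.range M, ∀ᶠ y in 𝓝 x, c' < k + gapPenalty C (a k) y := by
    intro k _
    have hk : c' < k + gapPenalty C (a k) x := hc'.trans_le (iInf_le _ k)
    by_cases h : x = a k
    · rw [h, gapPenalty_self, add_zero] at hk
      exact Eventually.of_forall fun y => hk.trans_le le_self_add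
    · exact (tendsto_const_nhds.add (continuousAt_gapPenalty h)).eventually_const_lt hk
  filter_upwards [(Finset.eventually_all _).2 key] with y hy
  refine hcc'.trans_le (le_iInf fun k => ?_)
  rcases lt_or_ge k M with hk | hk
  · exact (hy k (Finset.mem_range.2 hk)).le
  · exact hM.le.trans ((Nat.cast_le.2 hk).trans le_self_add)

theorem gapPotential_apply_le (k : ℕ) : gapPotential C a (a k) ≤ k :=
  (iInf_le _ k).trans (by simp [gapPenalty_self])

theorem gapPotential_eq_top (hx : x ∈ C) (h : x ∉ range a) : gapPotential C a x = ⊤ :=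
  iInf_eq_top.2 fun k => by
    rw [gapPenalty_eq_top hx fun e => h ⟨k, e.symm⟩, add_top]

theorem gapPotential_lt_top (hC : IsClosed C) (hx : x ∉ C) : gapPotential C a x < ⊤ := by
  refine (iInf_le _ 0).trans_lt ?_
  have h0 : infEDist x C ≠ 0 := fun h => hx ((mem_iff_infEDist_zero_of_closed hC).2 h)
  have : gapPenalty C (a 0) x < ⊤ := by
    refine ENNReal.div_lt_top (edist_ne_top _ _) fun h => h0 ?_
    simpa [ENNReal.rpow_eq_zero_iff, (by norm_num : ¬ (2 : ℝ) < 0)] using h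
  simpa using this

/-- Semicontinuity gives the lower half; a single term close to the infimum at `x` gives the upper
half. -/
theorem tendsto_gapPotential_of_le {l : Filter ℝ} (hl : l ≤ 𝓝 x)
    (h : ∀ k, gapPenalty C (a k) x < ⊤ →
      Tendsto (gapPenalty C (a k)) l (𝓝 (gapPenalty C (a k) x))) :
    Tendsto (gapPotential C a) l (𝓝 (gapPotential C a x)) := by
  refine tendsto_order.2 ⟨fun c hc => hl (lowerSemicontinuous_gapPotential x c hc),
    fun c hc => ?_⟩
  obtain ⟨k, hk⟩ := iInf_lt_iff.1 hc
  have hk' : gapPenalty C (a k) x < ⊤ := (le_add_self.trans_lt hk).trans_le le_top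
  filter_upwards [(tendsto_const_nhds.add (h k hk')).eventually_lt_const hk] with y hy
  exact (iInf_le _ k).trans_lt hy

theorem tendsto_gapPotential_of_notMem (ha : ∀ k, a k ∈ C) (hx : x ∉ C) :
    Tendsto (gapPotential C a) (𝓝 x) (𝓝 (gapPotential C a x)) :=
  tendsto_gapPotential_of_le le_rfl fun k _ =>
    continuousAt_gapPenalty fun h => hx (h ▸ ha k)

theorem tendsto_gapPotential_of_mem {l : Filter ℝ} {K : ℝ≥0∞} (hK : K ≠ ⊤) (hx : x ∈ C)
    (hl : l ≤ 𝓝 x) (h : ∀ᶠ y in l, edist y x ≤ K * infEDist y C) :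
    Tendsto (gapPotential C a) l (𝓝 (gapPotential C a x)) := by
  refine tendsto_gapPotential_of_le hl fun k hk => ?_
  obtain rfl : x = a k := by
    by_contra hne
    exact hk.ne (gapPenalty_eq_top hx hne)
  rw [gapPenalty_self]
  exact tendsto_gapPenalty hK hx hl h

/-- The condition `a i < x` switches at `x = a i`, but there `S x ≤ i`, so `S - i` tends to `0` and
no jump occurs. -/
theorem tendsto_gapCoord {l : Filter ℝ} (hl : l ≤ 𝓝 x)
    (hS : Tendsto (gapPotential C a) l (𝓝 (gapPotential C a x))) (i : ℕ) :
    Tendsto (gapCoord C a i) l (𝓝 (gapCoord C a i x)) := by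
  have hsub : Tendsto (fun y => gapPotential C a y - i) l (𝓝 (gapPotential C a x - i)) :=
    ((ENNReal.continuous_sub_right i).tendsto _).comp hS
  rcases lt_trichotomy (a i) x with h | h | h
  · rw [gapCoord, if_pos h]
    refine hsub.congr' ?_
    filter_upwards [hl (lt_mem_nhds h)] with y hy
    rw [gapCoord, if_pos hy]
  · rw [gapCoord, if_neg h.not_lt]
    have h0 : gapPotential C a x - i = 0 :=
      tsub_eq_zero_of_le (h ▸ gapPotential_apply_le i)
    rw [h0] at hsub
    refine tendsto_of_tendsto_of_tendsto_of_le_of_le tendsto_const_nhds hsub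
      (fun _ => zero_le) fun y => ?_
    rw [gapCoord]
    split_ifs
    exacts [le_rfl, zero_le]
  · rw [gapCoord, if_neg h.not_gt]
    refine tendsto_const_nhds.congr' ?_
    filter_upwards [hl (gt_mem_nhds h)] with y hy
    rw [gapCoord, if_neg (not_lt_of_gt hy)]

theorem lowerSemicontinuous_gapCoord (i : ℕ) :
    LowerSemicontinuous (gapCoord C a i) := by
  intro x c hc
  have h : a i < x := by
    by_contra h
    simp [gapCoord, h] at hc
  rw [gapCoord, if_pos h] at hc
  have hc' : c + i < gapPotential C a x := lt_tsub_iff_right.1 hc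
  filter_upwards [lt_mem_nhds h, lowerSemicontinuous_gapPotential x _ hc'] with y hy hy'
  rw [gapCoord, if_pos hy]
  exact lt_tsub_iff_right.2 hy'

/-- The map into the hyperspace attached to a closed set and an enumeration of some of its
points. -/
noncomputable def gapMap (C : Set ℝ) (a : ℕ → ℝ) (x : ℝ) : NonemptyClosedSubsets ℝ :=
  intervalUnion fun i => gapCoord C a i x

theorem tendsto_gapMap_of_lt_top {l : Filter ℝ} (hl : l ≤ 𝓝 x)
    (hS : Tendsto (gapPotential C a) l (𝓝 (gapPotential C a x)))
    (hx : gapPotential C a x < ⊤) : Tendsto (gapMap C a) l (𝓝 (gapMap C a x)) := by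
  obtain ⟨N, hN⟩ := ENNReal.exists_nat_gt hx.ne
  refine tendsto_intervalUnion (N := N) (tendsto_gapCoord hl hS) ?_
  -- Where `S < N`, all coordinates with index at least `N` vanish.
  filter_upwards [hS.eventually_lt_const hN] with y hy i hi
  rw [gapCoord]
  split_ifs
  · rw [tsub_eq_zero_of_le (hy.le.trans (Nat.cast_le.2 hi))]
    exact zero_le
  · exact zero_le

theorem tendsto_gapMap_of_eq_top {l : Filter ℝ} (hl : l ≤ 𝓝 x)
    (hx : gapPotential C a x = ⊤) (h : ∀ᶠ y in l, ∀ i, gapCoord C a i y ≤ gapCoord C a i x) :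
    Tendsto (gapMap C a) l (𝓝 (gapMap C a x)) := by
  have hS : Tendsto (gapPotential C a) l (𝓝 (gapPotential C a x)) :=
    tendsto_order.2 ⟨fun c hc => hl (lowerSemicontinuous_gapPotential x c hc),
      fun c hc => absurd hc (hx ▸ not_top_lt)⟩
  exact tendsto_intervalUnion (N := 0) (tendsto_gapCoord hl hS) (h.mono fun y hy i _ => hy i)

theorem gapCoord_eq_top (hx : gapPotential C a x = ⊤) {i : ℕ} (h : a i < x) :
    gapCoord C a i x = ⊤ := by
  rw [gapCoord, if_pos h, hx, ENNReal.top_sub (ENNReal.natCast_ne_top i)]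

/-- At `x ∈ C` off the range of `a`, each coordinate with `a i < x` is infinite, and `a i < y < x`
activates no others; so values at the left are dominated. -/
theorem tendsto_gapMap_nhdsLT (hC : IsClosed C) (ha : ∀ k, a k ∈ C)
    (hx : x ∉ range a) : Tendsto (gapMap C a) (𝓝[<] x) (𝓝 (gapMap C a x)) := by
  by_cases hxC : x ∈ C
  · have htop := gapPotential_eq_top hxC hx
    refine tendsto_gapMap_of_eq_top nhdsWithin_le_nhds htop ?_
    filter_upwards [self_mem_nhdsWithin] with y hy i
    by_cases h : a i < y
    · rw [gapCoord_eq_top htop (h.trans hy)]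
      exact le_top
    · simp [gapCoord, h]
  · exact tendsto_gapMap_of_lt_top nhdsWithin_le_nhds
      ((tendsto_gapPotential_of_notMem ha hxC).mono_left nhdsWithin_le_nhds)
      (gapPotential_lt_top hC hxC)

theorem mapClusterPt_of_frequently {X Y : Type*} [TopologicalSpace Y] {f : X → Y} {y : Y}
    {l : Filter X} {s : Set X} (hs : ∃ᶠ x in l, x ∈ s) (h : Tendsto f (l ⊓ 𝓟 s) (𝓝 y)) :
    MapClusterPt y l f := by
  have : NeBot (l ⊓ 𝓟 s) := frequently_mem_iff_neBot.1 hs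
  exact h.mapClusterPt.mono inf_le_left

/-- At a point of `range a` the porosity hypothesis supplies an approach from the left along which
the penalty tends to `0`. -/
theorem mapClusterPt_gapMap_nhdsLT (hC : IsClosed C) (ha : ∀ k, a k ∈ C) {K : ℝ≥0∞} (hK : K ≠ ⊤)
    (hpor : ∀ x ∈ range a, ∃ᶠ y in 𝓝[<] x, edist y x ≤ K * infEDist y C) (x : ℝ) :
    MapClusterPt (gapMap C a x) (𝓝[<] x) (gapMap C a) := by
  by_cases hx : x ∈ range a
  · refine mapClusterPt_of_frequently (hpor x hx) ?_
    have hl : 𝓝[<] x ⊓ 𝓟 {y | edist y x ≤ K * infEDist y C} ≤ 𝓝 x :=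
      inf_le_left.trans nhdsWithin_le_nhds
    obtain ⟨k, rfl⟩ := hx
    exact tendsto_gapMap_of_lt_top hl
      (tendsto_gapPotential_of_mem hK (ha k) hl (mem_inf_of_right (mem_principal_self _)))
      ((gapPotential_apply_le k).trans_lt (ENNReal.natCast_lt_top k))
  · exact (tendsto_gapMap_nhdsLT hC ha hx).mapClusterPt

theorem mapClusterPt_gapMap_nhdsGT (hC : IsClosed C) (ha : range a = rightIsolated C)
    (hdense : ∀ x ∈ C, x ∉ range a → ∃ᶠ y in 𝓝[>] x, y ∈ range a) (x : ℝ) :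
    MapClusterPt (gapMap C a x) (𝓝[>] x) (gapMap C a) := by
  have haC : ∀ k, a k ∈ C := fun k => (ha ▸ mem_range_self k : a k ∈ rightIsolated C).1
  by_cases hxC : x ∈ C
  · by_cases hx : x ∈ range a
    · have hgap := (mem_rightIsolated_iff.1 (ha ▸ hx)).2
      obtain ⟨v, hv, hxv⟩ := mem_nhdsGT_iff_exists_Ioo_subset.1 hgap
      have hev : ∀ᶠ y in 𝓝[>] x, edist y x ≤ 1 * infEDist y C := by
        -- In the left half of the gap `(x, v)` the nearest point of `C` is `x`.
        filter_upwards [Ioo_mem_nhdsGT (left_lt_add_div_two.2 hv)] with y hy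
        rw [one_mul]
        refine le_infEDist.2 fun c hc => ?_
        rw [edist_dist, edist_dist, Real.dist_eq, Real.dist_eq]
        refine ENNReal.ofReal_le_ofReal ?_
        rw [abs_of_pos (sub_pos.2 hy.1)]
        rcases le_or_gt c x with h | h
        · exact (by linarith : y - x ≤ y - c).trans (le_abs_self _)
        · have hcv : v ≤ c := not_lt.1 fun hcv => hxv ⟨h, hcv⟩ hc
          rw [abs_sub_comm]
          exact (by linarith [hy.2] : y - x ≤ c - y).trans (le_abs_self _)
      have hfin : gapPotential C a x < ⊤ := by
        obtain ⟨k, rfl⟩ := hx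
        exact (gapPotential_apply_le k).trans_lt (ENNReal.natCast_lt_top k)
      exact (tendsto_gapMap_of_lt_top nhdsWithin_le_nhds (tendsto_gapPotential_of_mem
        ENNReal.one_ne_top hxC nhdsWithin_le_nhds hev) hfin).mapClusterPt
    · have htop := gapPotential_eq_top hxC hx
      have hfreq : ∃ᶠ y in 𝓝[>] x, y ∈ {y | ∀ i, gapCoord C a i y ≤ gapCoord C a i x} := by
        refine frequently_iff.2 fun {U} hU => ?_
        obtain ⟨v, hv, hxv⟩ := mem_nhdsGT_iff_exists_Ioo_subset.1 hU
        have hex : ∃ k, a k ∈ Ioo x v := by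
          obtain ⟨_, ⟨k, rfl⟩, hk⟩ :=
            ((hdense x hxC hx).and_eventually (Ioo_mem_nhdsGT hv)).exists
          exact ⟨k, hk⟩
        classical
        -- Take the least index `k` with `a k ∈ (x, v)`. An earlier `a i < a k` lies left of `x`,
        -- where the coordinate at `x` is infinite; for `i ≥ k` the coordinate at `a k` vanishes
        -- since `S (a k) ≤ k`.
        refine ⟨a (Nat.find hex), hxv (Nat.find_spec hex), fun i => ?_⟩
        by_cases hi : a i < a (Nat.find hex)
        · by_cases hik : i < Nat.find hex
          · have hix : a i < x := by
              by_contra hxi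
              refine Nat.find_min hex hik ⟨lt_of_le_of_ne (not_lt.1 hxi) fun e => hx ⟨i, e.symm⟩,
                hi.trans (Nat.find_spec hex).2⟩
            rw [gapCoord_eq_top htop hix]
            exact le_top
          · rw [gapCoord, if_pos hi, tsub_eq_zero_of_le]
            · exact zero_le
            · exact (gapPotential_apply_le _).trans (Nat.cast_le.2 (not_lt.1 hik))
        · rw [gapCoord, if_neg hi]
          exact zero_le
      exact mapClusterPt_of_frequently hfreq (tendsto_gapMap_of_eq_top
        (inf_le_left.trans nhdsWithin_le_nhds) htop (mem_inf_of_right (mem_principal_self _)))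
  · exact (tendsto_gapMap_of_lt_top nhdsWithin_le_nhds
      ((tendsto_gapPotential_of_notMem haC hxC).mono_left nhdsWithin_le_nhds)
      (gapPotential_lt_top hC hxC)).mapClusterPt

/-! ### Discontinuity along the closed set. -/

/-- Every neighbourhood of every point of `C` contains `a i < y` with `i` large and `y` a point of
`C` outside of the range of `a`. -/
def HasDenseJumps (C : Set ℝ) (a : ℕ → ℝ) : Prop :=
  ∀ z ∈ C, ∀ U ∈ 𝓝 z, ∀ N : ℕ, ∃ i ≥ N, ∃ y ∈ C, y ∉ range a ∧ a i < y ∧ a i ∈ U ∧ y ∈ U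

theorem HasDenseJumps.exists_mem_of_mem_nhdsGT (h : HasDenseJumps C a)
    (ha : range a = rightIsolated C) (hxC : x ∈ C) (hx : x ∉ range a) {U : Set ℝ}
    (hU : U ∈ 𝓝[>] x) : ∃ i, ∃ y ∈ C, y ∉ range a ∧ x < a i ∧ a i < y ∧ a i ∈ U ∧ y ∈ U := by
  obtain ⟨v, hv, hxv⟩ := mem_nhdsGT_iff_exists_Ioo_subset.1 hU
  rw [ha, mem_rightIsolated_iff, not_and, not_eventually] at hx
  obtain ⟨z, hzC, hz⟩ := ((hx hxC).and_eventually (Ioo_mem_nhdsGT hv)).exists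
  obtain ⟨i, -, y, hyC, hya, hiy, hi, hy⟩ := h z (not_not.1 hzC) _ (Ioo_mem_nhds hz.1 hz.2) 0
  exact ⟨i, y, hyC, hya, hi.1, hiy, hxv hi, hxv hy⟩

theorem HasDenseJumps.frequently_mem_range (h : HasDenseJumps C a)
    (ha : range a = rightIsolated C) (hxC : x ∈ C) (hx : x ∉ range a) :
    ∃ᶠ y in 𝓝[>] x, y ∈ range a :=
  frequently_iff.2 fun hU =>
    let ⟨i, _, _, _, _, _, hi, _⟩ := h.exists_mem_of_mem_nhdsGT ha hxC hx hU
    ⟨a i, hi, i, rfl⟩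

/-- At `y ∈ C` off the range of `a`, coordinate `i` is infinite once `a i < y`. It vanishes at `x =
a k` if `i ≥ k`, and at any `x < a i`. -/
theorem not_continuousAt_domRestrict_gapMap (ha : range a = rightIsolated C)
    (h : HasDenseJumps C a) (x : C) : ¬ ContinuousAt (C.domRestrict (gapMap C a)) x := by
  refine not_continuousAt_intervalUnion (g := fun i (y : C) => gapCoord C a i y)
    (frequently_iff.2 fun {T} hT => ?_)
  obtain ⟨U, hU, hUT⟩ := (mem_nhds_subtype C x T).1 hT
  have one_le : ∀ i, ∀ y ∈ C, y ∉ range a → a i < y → 1 ≤ gapCoord C a i y :=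
    fun i y hyC hya hiy => by
      rw [gapCoord_eq_top (gapPotential_eq_top hyC hya) hiy]
      exact le_top
  by_cases hx : (x : ℝ) ∈ range a
  · obtain ⟨k, hk⟩ := hx
    obtain ⟨i, hi, y, hyC, hya, hiy, -, hyU⟩ := h x x.2 U hU k
    refine ⟨⟨y, hyC⟩, hUT hyU, i, ?_, one_le i y hyC hya hiy⟩
    have : gapPotential C a x - i = 0 :=
      tsub_eq_zero_of_le (hk ▸ (gapPotential_apply_le k).trans (Nat.cast_le.2 hi))
    simp [gapCoord, this]
  · obtain ⟨i, y, hyC, hya, hxi, hiy, -, hyU⟩ :=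
      h.exists_mem_of_mem_nhdsGT ha x.2 hx (mem_nhdsWithin_of_mem_nhds hU)
    refine ⟨⟨y, hyC⟩, hUT hyU, i, ?_, one_le i y hyC hya hiy⟩
    simp [gapCoord, hxi.not_gt]

end

/-! ### Porosity and dense jumps of the Cantor set. -/

section CantorSet

theorem div_three_mem_cantorSet {x : ℝ} (hx : x ∈ cantorSet) : x / 3 ∈ cantorSet := by
  rw [cantorSet_eq_union_halves]
  exact Or.inl ⟨x, hx, rfl⟩

theorem two_add_div_three_mem_cantorSet {x : ℝ} (hx : x ∈ cantorSet) :
    (2 + x) / 3 ∈ cantorSet := by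
  rw [cantorSet_eq_union_halves]
  exact Or.inr ⟨x, hx, rfl⟩

theorem one_mem_cantorSet : (1 : ℝ) ∈ cantorSet := by
  refine mem_iInter.2 fun n => ?_
  induction n with
  | zero => simp
  | succ n ih => exact Or.inr ⟨1, ih, by norm_num⟩

theorem inv_three_pow_mem_cantorSet (n : ℕ) : ((3 : ℝ) ^ n)⁻¹ ∈ cantorSet := by
  induction n with
  | zero => simpa using one_mem_cantorSet
  | succ n ih =>
    have := div_three_mem_cantorSet ih
    rwa [pow_succ, mul_inv, ← div_eq_mul_inv]

/-- Every point of the Cantor set lies in a triadic copy of the Cantor set of any level. -/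
theorem exists_triadic_copy_cantorSet {x : ℝ} (hx : x ∈ cantorSet) (n : ℕ) :
    ∃ m : ℤ, (∃ t ∈ cantorSet, x = (m + t) / 3 ^ n) ∧
      ∀ t ∈ cantorSet, (m + t) / 3 ^ n ∈ cantorSet := by
  induction n with
  | zero => exact ⟨0, ⟨x, hx, by simp⟩, fun t ht => by simpa using ht⟩
  | succ n ih =>
    obtain ⟨m, ⟨t, ht, rfl⟩, hm⟩ := ih
    rw [cantorSet_eq_union_halves] at ht
    rcases ht with ⟨s, hs, rfl⟩ | ⟨s, hs, rfl⟩
    · refine ⟨3 * m, ⟨s, hs, ?_⟩, fun t ht => ?_⟩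
      · push_cast
        rw [pow_succ]
        field_simp
      · convert hm _ (div_three_mem_cantorSet ht) using 1
        push_cast
        rw [pow_succ]
        field_simp
    · refine ⟨3 * m + 2, ⟨s, hs, ?_⟩, fun t ht => ?_⟩
      · push_cast
        rw [pow_succ]
        field_simp
        ring
      · convert hm _ (two_add_div_three_mem_cantorSet ht) using 1
        push_cast
        rw [pow_succ]
        field_simp
        ring

/-- The triadic middle thirds are disjoint from the Cantor set. -/
theorem notMem_cantorSet_of_mem_Ioo {x : ℝ} {n : ℕ} {m : ℤ}
    (hx : x * 3 ^ n ∈ Ioo (m + 1 / 3 : ℝ) (m + 2 / 3)) : x ∉ cantorSet := by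
  intro hxC
  obtain ⟨k, ⟨t, ht, rfl⟩, -⟩ := exists_triadic_copy_cantorSet hxC n
  rw [div_mul_cancel₀ _ (by positivity)] at hx
  obtain ⟨h0, h1⟩ := cantorSet_subset_unitInterval ht
  have hkm : k = m := by
    have h2 : (k : ℝ) < m + 1 := by linarith [hx.2]
    have h3 : (m : ℝ) < k + 1 := by linarith [hx.1]
    have h2' : k < m + 1 := by exact_mod_cast h2
    have h3' : m < k + 1 := by exact_mod_cast h3
    omega
  subst hkm
  rw [cantorSet_eq_union_halves] at ht
  rcases ht with ⟨s, hs, rfl⟩ | ⟨s, hs, rfl⟩ <;>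
    obtain ⟨hs0, hs1⟩ := cantorSet_subset_unitInterval hs <;>
    simp only [mem_Ioo] at hx
  · linarith [hx.1]
  · linarith [hx.2]

theorem frequently_edist_le_infEDist_cantorSet (x : ℝ) :
    ∃ᶠ y in 𝓝[<] x, edist y x ≤ 9 * infEDist y cantorSet := by
  refine frequently_iff.2 fun {U} hU => ?_
  obtain ⟨v, hv, hvU⟩ := mem_nhdsLT_iff_exists_Ioo_subset.1 hU
  have hvx : 0 < (x - v) / 2 := half_pos (sub_pos.2 hv)
  obtain ⟨n, hn⟩ := exists_pow_lt_of_lt_one hvx (by norm_num : (1 / 3 : ℝ) < 1)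
  rw [one_div, inv_pow] at hn
  have hp : (0 : ℝ) < 3 ^ n := by positivity
  -- The triadic cell just before the one containing `x` is used, so that its midpoint `y` lies left
  -- of `x`. Then `x - y ≤ (3 / 2) * 3⁻ⁿ`, while `y` is at least `3⁻ⁿ / 6` away from the Cantor set;
  -- the ratio is `9`.
  set m : ℤ := ⌊x * 3 ^ n⌋ - 1 with hm
  have hm1 : (m : ℝ) + 1 ≤ x * 3 ^ n := by
    have := Int.floor_le (x * 3 ^ n)
    rw [hm]; push_cast; linarith
  have hm2 : x * 3 ^ n < m + 2 := by
    have := Int.lt_floor_add_one (x * 3 ^ n)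
    rw [hm]; push_cast; linarith
  set y : ℝ := (m + 1 / 2) / 3 ^ n with hy
  have hyn : y * 3 ^ n = m + 1 / 2 := div_mul_cancel₀ _ hp.ne'
  have hinv : (3 ^ n : ℝ)⁻¹ * 3 ^ n = 1 := inv_mul_cancel₀ hp.ne'
  have hyx : y < x := lt_of_mul_lt_mul_right (by linarith) hp.le
  have hxy : x - y ≤ 3 / 2 * (3 ^ n : ℝ)⁻¹ :=
    le_of_mul_le_mul_right (by rw [mul_assoc, hinv, sub_mul]; linarith) hp
  refine ⟨y, hvU ⟨by linarith, hyx⟩, ?_⟩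
  have hdist : ENNReal.ofReal (1 / 6 * (3 ^ n : ℝ)⁻¹) ≤ infEDist y cantorSet := by
    refine le_infEDist.2 fun c hc => ?_
    rw [edist_dist, Real.dist_eq]
    refine ENNReal.ofReal_le_ofReal ?_
    by_contra hlt
    have habs := abs_lt.1 (not_le.1 hlt)
    refine notMem_cantorSet_of_mem_Ioo (n := n) (m := m) ⟨?_, ?_⟩ hc
    · have := mul_lt_mul_of_pos_right habs.2 hp
      rw [mul_assoc, hinv, sub_mul] at this
      linarith
    · have := mul_lt_mul_of_pos_right habs.1 hp
      rw [neg_mul, mul_assoc, hinv, sub_mul] at this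
      linarith
  calc edist y x = ENNReal.ofReal (x - y) := by
        rw [edist_dist, Real.dist_eq, abs_sub_comm, abs_of_pos (sub_pos.2 hyx)]
    _ ≤ ENNReal.ofReal (9 * (1 / 6 * (3 ^ n : ℝ)⁻¹)) := ENNReal.ofReal_le_ofReal (by linarith)
    _ = 9 * ENNReal.ofReal (1 / 6 * (3 ^ n : ℝ)⁻¹) := by
        rw [ENNReal.ofReal_mul (by norm_num)]
        norm_num
    _ ≤ _ := by gcongr

/-- In the copy of level `n`, the gap starting at `3⁻⁽ʲ⁺¹⁾` is a middle third of level `n + j`. -/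
theorem mem_rightIsolated_cantorSet {n : ℕ} {m : ℤ}
    (h : ∀ t ∈ cantorSet, (m + t) / 3 ^ n ∈ cantorSet) (j : ℕ) :
    ((m + (3 ^ (j + 1))⁻¹) / 3 ^ n : ℝ) ∈ rightIsolated cantorSet := by
  refine mem_rightIsolated_iff.2 ⟨h _ (inv_three_pow_mem_cantorSet _), ?_⟩
  have hn : (0 : ℝ) < 3 ^ n := by positivity
  have hj : (0 : ℝ) < 3 ^ j := by positivity
  have hlt : (m + (3 ^ (j + 1))⁻¹ : ℝ) / 3 ^ n < (m + 2 * (3 ^ (j + 1))⁻¹) / 3 ^ n := by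
    have : (0 : ℝ) < (3 ^ (j + 1))⁻¹ := by positivity
    gcongr
    linarith
  filter_upwards [Ioo_mem_nhdsGT hlt] with y hy
  refine notMem_cantorSet_of_mem_Ioo (n := n + j) (m := m * 3 ^ j) ?_
  have e : ∀ s : ℝ, (m + s * (3 ^ (j + 1))⁻¹ : ℝ) / 3 ^ n * 3 ^ (n + j) = m * 3 ^ j + s / 3 := by
    intro s
    rw [pow_add, pow_succ]
    field_simp
    ring
  have h1 := mul_lt_mul_of_pos_right hy.1 (by positivity : (0 : ℝ) < 3 ^ (n + j))
  have h2 := mul_lt_mul_of_pos_right hy.2 (by positivity : (0 : ℝ) < 3 ^ (n + j))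
  have e1 := e 1
  rw [one_mul] at e1
  rw [e1] at h1
  rw [e 2] at h2
  push_cast
  exact ⟨h1, h2⟩

theorem hasDenseJumps_cantorSet {a : ℕ → ℝ} (ha : range a = rightIsolated cantorSet) :
    HasDenseJumps cantorSet a := by
  intro z hz U hU N
  obtain ⟨ε, hε, hball⟩ := Metric.mem_nhds_iff.1 hU
  obtain ⟨n, hn⟩ := exists_pow_lt_of_lt_one hε (by norm_num : (1 / 3 : ℝ) < 1)
  rw [one_div, inv_pow] at hn
  have hp : (0 : ℝ) < 3 ^ n := by positivity
  obtain ⟨m, ⟨t, ht, rfl⟩, hm⟩ := exists_triadic_copy_cantorSet hz n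
  have hsub : ∀ s ∈ cantorSet, (m + s) / 3 ^ n ∈ U := fun s hs => hball <| by
    obtain ⟨ht0, ht1⟩ := cantorSet_subset_unitInterval ht
    obtain ⟨hs0, hs1⟩ := cantorSet_subset_unitInterval hs
    rw [mem_ball, Real.dist_eq, ← sub_div, abs_div, abs_of_pos hp, div_eq_mul_inv]
    refine lt_of_le_of_lt (mul_le_of_le_one_left (by positivity) ?_) hn
    exact abs_le.2 ⟨by linarith, by linarith⟩
  -- A small copy contains infinitely many right-isolated points, so one of them has all its indices
  -- at least `N`.
  have hinj : Function.Injective fun j : ℕ => (m + (3 ^ (j + 1))⁻¹ : ℝ) / 3 ^ n := by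
    intro i j hij
    have h1 := add_left_cancel ((div_left_inj' hp.ne').1 hij)
    have h2 := pow_right_injective₀ (by norm_num : (0 : ℝ) < 3) (by norm_num) (inv_injective h1)
    exact Nat.succ_injective h2
  obtain ⟨_, ⟨j, rfl⟩, hj⟩ := (infinite_range_of_injective hinj).exists_notMem_finite
    ((finite_Iio N).image a)
  have hjA := mem_rightIsolated_cantorSet hm j
  obtain ⟨i, hi⟩ : (m + (3 ^ (j + 1))⁻¹ : ℝ) / 3 ^ n ∈ range a := ha ▸ hjA
  have h23 : ∀ s ∈ cantorSet, (m + (2 + s) / 3) / 3 ^ n ∈ cantorSet := fun s hs =>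
    hm _ (two_add_div_three_mem_cantorSet hs)
  -- The point `y` is the `2 / 3` of the copy, a limit from the right of the points `(2 + 3⁻ᵏ) / 3`.
  refine ⟨i, not_lt.1 fun hiN => hj ⟨i, hiN, hi⟩, (m + (2 + 0) / 3) / 3 ^ n,
    h23 0 zero_mem_cantorSet, ?_, ?_, hi ▸ hsub _ (inv_three_pow_mem_cantorSet _),
    hsub _ (two_add_div_three_mem_cantorSet zero_mem_cantorSet)⟩
  · rw [ha, mem_rightIsolated_iff, not_and, not_eventually]
    intro _
    have hlim : Tendsto (fun k : ℕ => (m + (2 + ((3 : ℝ) ^ k)⁻¹) / 3) / 3 ^ n) atTop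
        (𝓝 ((m + (2 + 0) / 3) / 3 ^ n)) := by
      refine Tendsto.div_const (tendsto_const_nhds.add ((tendsto_const_nhds.add ?_).div_const _)) _
      exact tendsto_inv_atTop_zero.comp (tendsto_pow_atTop_atTop_of_one_lt (by norm_num))
    have hgt : ∀ k : ℕ, (m + (2 + ((3 : ℝ) ^ k)⁻¹) / 3) / 3 ^ n ∈
        Ioi ((m + (2 + 0) / 3 : ℝ) / 3 ^ n) := fun k => by
      have : (0 : ℝ) < ((3 : ℝ) ^ k)⁻¹ := by positivity
      exact div_lt_div_of_pos_right (by linarith) hp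
    have hlim' := tendsto_nhdsWithin_iff.2 ⟨hlim, Eventually.of_forall hgt⟩
    refine hlim'.frequently (Frequently.of_forall fun k => ?_)
    exact not_not.2 (h23 _ (inv_three_pow_mem_cantorSet k))
  · rw [hi]
    have : ((3 : ℝ) ^ (j + 1))⁻¹ ≤ 1 / 3 := by
      rw [pow_succ, mul_inv, one_div]
      exact mul_le_of_le_one_left (by norm_num) (inv_le_one_of_one_le₀ (one_le_pow₀ (by norm_num)))
    gcongr
    linarith

end CantorSet

theorem mainTheorem5 :
    ∃ f : ℝ → NonemptyClosedSubsets ℝ,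
      IsBaireOne f ∧ FSigmaMeasurable f ∧ IsDarboux f ∧
      (∀ x : cantorSet, ¬ ContinuousAt (cantorSet.domRestrict f) x) ∧
      ¬ BarelyContinuous f ∧
      HereditarilyLindelofSpace (Set.range f) ∧
      T6Space (Set.range f) := by
  have hne : (rightIsolated cantorSet).Nonempty :=
    ⟨_, mem_rightIsolated_cantorSet (n := 0) (m := 0) (by simp) 0⟩
  obtain ⟨a, ha⟩ := (countable_rightIsolated cantorSet).exists_eq_range hne
  replace ha := ha.symm
  have haC : ∀ k, a k ∈ cantorSet := fun k =>
    (ha ▸ mem_range_self k : a k ∈ rightIsolated cantorSet).1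
  have hjumps := hasDenseJumps_cantorSet ha
  have hleft : ∀ x ∉ range a, Tendsto (gapMap cantorSet a) (𝓝[<] x) (𝓝 (gapMap cantorSet a x)) :=
    fun x hx => tendsto_gapMap_nhdsLT isClosed_cantorSet haC hx
  have hsigma := FSigmaMeasurable.of_tendsto_nhdsLT (countable_range a) hleft
  have hdisc := not_continuousAt_domRestrict_gapMap ha hjumps
  have hHL := hereditarilyLindelofSpace_range_of_tendsto_nhdsLT (countable_range a) hleft
  refine ⟨gapMap cantorSet a, isBaireOne_intervalUnion lowerSemicontinuous_gapCoord, hsigma,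
    hsigma.isDarboux ?_ ?_, hdisc, fun h => ?_, hHL, ?_⟩
  · exact mapClusterPt_gapMap_nhdsLT isClosed_cantorSet haC (by norm_num : (9 : ℝ≥0∞) ≠ ⊤)
      fun x _ => frequently_edist_le_infEDist_cantorSet x
  · exact mapClusterPt_gapMap_nhdsGT isClosed_cantorSet ha fun x hxC hx =>
      hjumps.frequently_mem_range ha hxC hx
  · obtain ⟨x, hx⟩ := h cantorSet isClosed_cantorSet ⟨0, zero_mem_cantorSet⟩
    exact hdisc x hx
  · exact T6Space.of_regularSpace_hereditarilyLindelofSpace _
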